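/- **Theorem 1 (Main Result).** Fix integers $m,t,L\ge 1$ (for $n=0$, also $L=0$ is allowed). For $\mathbf a\in\mathbb R^n$, a *Weighted MinHash sketch* of $\mathbf a$ with $m$ samples and discretization parameter $L$ is computed as follows. - *Rounding.* Let $\mathbf z=\mathbf a/\|\mathbf a\|$ and $\mathbf z'[i]=\operatorname{sign}(\mathbf z[i])\sqrt{\lfloor \mathbf z[i]^2L\rfloor/L}$. Let $i^*$ be the first index maximizing $|\mathbf z[i]|$. Set $\tilde{\mathbf a}[i]=\mathbf z'[i]$ for $i\ne i^*$ and $\tilde{\mathbf a}[i^*]=\operatorname{sign}(\mathbf z[i^*])\sqrt{\mathbf z'[i^*]^2+1-\|\mathbf z'\|^2}$. - *Extension.* Let $\bar{\mathbf a}\in\mathbb R^{nL}$ be the concatenation of $n$ blocks of length $L$, where the first $\tilde{\mathbf a}[i]^2L$ entries of block $i$ equal $\tilde{\mathbf a}[i]$ and the remaining ones are $0$. - *Hashing.* For $i=1,\dots,m$, given a hash function $h^i:\{1,\dots,nL\}\to[0,1]$, let $j^*=\arg\min_{j:\bar{\mathbf a}[j]\neq0}h^i(j)$ and set $W^{hash}_{\mathbf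 a}[i]=h^i(j^*)$, $W^{val}_{\mathbf a}[i]=\bar{\mathbf a}[j^*]$. - The sketch is $W_{\mathbf a}=\{W^{hash}_{\mathbf a},W^{val}_{\mathbf a},\|\mathbf a\|\}$. (For $\mathbf a=\mathbf 0$, put $W^{hash}_{\mathbf a}[i]=W^{val}_{\mathbf a}[i]=0$.) From two sketches $W_{\mathbf a},W_{\mathbf b}$ computed with the same hash functions, the *Weighted MinHash estimate* is $$\|\mathbf a\|\,\|\mathbf b\|\cdot\frac{\tilde M}{m}\sum_{i=1}^m \mathbb 1\!\left[W^{hash}_{\mathbf a}[i]=W^{hash}_{\mathbf b}[i]\right]\frac{W^{val}_{\mathbf a}[i]\,W^{val}_{\mathbf b}[i]}{\min(W^{val}_{\mathbf a}[i]^2,W^{val}_{\mathbf b}[i]^2)},\qquad \tilde M=\frac1L\left(\frac{m}{\sum_{i=1}^m\min(W^{hash}_{\mathbf a}[i],W^{hash}_{\mathbf b}[i])}-1\right),$$ understood to be $0$ if $\mathbf a=\mathbf 0$ or $\mathbf b=\mathbf 0$. Let $\mathcal S(\mathbf a)$ be the concatenation of $t$ such sketches of $\mathbf a$, all $tm$ hash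 functions being independent and uniformly random (all hash values independent and uniform on $[0,1]$) and shared between all sketched vectors; its size is the total number $tm$ of samples. Let $\mathcal F(\mathcal S(\mathbf a),\mathcal S(\mathbf b))$ be the median of the $t$ Weighted MinHash estimates computed from corresponding pairs of sketches. There is an absolute constant $C>0$ such that for all $\epsilon,\delta\in(0,1)$ there are positive integers $m,t$, depending only on $\epsilon$ and $\delta$, with total sketch size $$tm\le C\,\frac{\max(1,\log(1/\delta))}{\epsilon^2},$$ such that for every $n$, every integer $L\ge C n^6/\epsilon^2$ and all $\mathbf a,\mathbf b\in\mathbb R^n$, with probability at least $1-\delta$, $$\left|\mathcal F(\mathcal S(\mathbf a),\mathcal S(\mathbf b))-\langle\mathbf a,\mathbf b\rangle\right|\le\epsilon\max\left(\|\mathbf a_{\mathcal I}\|\|\mathbf b\|,\ \|\mathbf a\|\|\mathbf b_{\mathcal I}\|\right),$$ where $\mathcal I=\{i:\mathbf a[i]\ne0\text{ and }\mathbf b[i]\neq0\}$ and $\mathbf a_{\mathcal I},\mathbf b_{\mathcal I}$ are $\mathbf a,\mathbf b$ restricted to the indices in $\mathcal I$. -/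

import Mathlib

open MeasureTheory

noncomputable section

namespace WMH

/-- The smallest index in `s` at which `f` attains its minimum over `s` (`none` if `s` is empty). -/
def firstArgmin {N : ℕ} (s : Finset (Fin N)) (f : Fin N → ℝ) : Option (Fin N) :=
  if h : (s.filter fun j => ∀ k ∈ s, f j ≤ f k).Nonempty then
    some ((s.filter fun j => ∀ k ∈ s, f j ≤ f k).min' h)
  else none

theorem firstArgmin_isSome {N : ℕ} (s : Finset (Fin N)) (f : Fin N → ℝ) (hs : s.Nonempty) :
    ∃ j, firstArgmin s f = some j ∧ j ∈ s ∧ ∀ k ∈ s, f j ≤ f k := by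
  obtain ⟨j, hj, hmin⟩ := s.exists_min_image f hs
  have h : (s.filter fun j => ∀ k ∈ s, f j ≤ f k).Nonempty :=
    ⟨j, Finset.mem_filter.2 ⟨hj, hmin⟩⟩
  exact ⟨_, dif_pos h, Finset.mem_filter.1 (Finset.min'_mem _ h)⟩

/-- First pass of the rounding: every squared entry is rounded down to a multiple of `1 / L`. -/
def roundDown {n : ℕ} (L : ℕ) (z : EuclideanSpace ℝ (Fin n)) : EuclideanSpace ℝ (Fin n) :=
  WithLp.toLp 2 fun i => Real.sign (z i) * √((⌊z i ^ 2 * L⌋ : ℝ) / L)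

/-- Rounding of a unit vector `z`: after `roundDown`, the missing squared mass is given to the
(first) entry of largest magnitude. -/
def round {n : ℕ} (L : ℕ) (z : EuclideanSpace ℝ (Fin n)) : EuclideanSpace ℝ (Fin n) :=
  WithLp.toLp 2 fun i =>
    if firstArgmin Finset.univ (fun k => -|z k|) = some i then
      Real.sign (z i) * √(roundDown L z i ^ 2 + (1 - ‖roundDown L z‖ ^ 2))
    else roundDown L z i

/-- The rounded normalisation `ã` of `a`. -/
def normRound {n : ℕ} (L : ℕ) (a : EuclideanSpace ℝ (Fin n)) : EuclideanSpace ℝ (Fin n) :=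
  round L (‖a‖⁻¹ • a)

/-- The extended vector `ā` of length `n * L`: the concatenation of `n` blocks of length `L`,
where the first `ã i ^ 2 * L` entries of block `i` equal `ã i` and the others are `0`.
(`j.divNat` is the block of position `j`, and `j.modNat` its offset in that block, from `0`.) -/
def extend {n : ℕ} (L : ℕ) (a : EuclideanSpace ℝ (Fin n)) (j : Fin (n * L)) : ℝ :=
  if ((j.modNat : ℕ) : ℝ) < normRound L a j.divNat ^ 2 * L then normRound L a j.divNat else 0

/-- A Weighted MinHash sketch with `m` samples. -/
structure Sketch (m : ℕ) where
  /-- The minimal hash values. -/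
  hash : Fin m → ℝ
  /-- The entries at which they are attained. -/
  val : Fin m → ℝ
  /-- The Euclidean norm of the sketched vector. -/
  norm : ℝ

/-- The outcome of the random seed for one sketch: `m` hash functions `Fin (n * L) → [0, 1]`.
Its `volume` is the product measure, under which all hash values are independent and uniform. -/
abbrev Hashes (n L m : ℕ) : Type := Fin m → Fin (n * L) → unitInterval

/-- The index `j*` selected by a hash function: the minimiser of the hash value over the
nonzero positions of the extended vector. It is `none` if there are no such positions,
which happens for the zero vector. -/
def selected {n : ℕ} (L : ℕ) (a : EuclideanSpace ℝ (Fin n)) (h : Fin (n * L) → unitInterval) :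
    Option (Fin (n * L)) :=
  firstArgmin (Finset.univ.filter fun j => extend L a j ≠ 0) (fun j => (h j : ℝ))

/-- The Weighted MinHash sketch of `a`, computed from the hash functions `h`. -/
def sketch {n m : ℕ} (L : ℕ) (h : Hashes n L m) (a : EuclideanSpace ℝ (Fin n)) : Sketch m where
  hash i := (selected L a (h i)).elim 0 fun j => (h i j : ℝ)
  val i := (selected L a (h i)).elim 0 (extend L a)
  norm := ‖a‖

/-- The estimate `M̃` of the weighted union size. -/
def unionEstimate {m : ℕ} (L : ℕ) (A B : Sketch m) : ℝ :=
  1 / (L : ℝ) * ((m : ℝ) / (∑ i, min (A.hash i) (B.hash i)) - 1)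

/-- The Weighted MinHash estimate of an inner product from two sketches. -/
def estimate {m : ℕ} (L : ℕ) (A B : Sketch m) : ℝ :=
  A.norm * B.norm * (unionEstimate L A B / m *
    ∑ i, if A.hash i = B.hash i then
      A.val i * B.val i / min (A.val i ^ 2) (B.val i ^ 2) else 0)

/-- The median of `t` numbers: the average of the two middle ones (which coincide for odd `t`)
when they are listed in increasing order. -/
def median {t : ℕ} (x : Fin t → ℝ) : ℝ :=
  if ht : 0 < t then
    (x (Tuple.sort x ⟨(t - 1) / 2, by omega⟩) + x (Tuple.sort x ⟨t / 2, by omega⟩)) / 2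
  else 0

/-- The concatenation of `t` Weighted MinHash sketches with `m` samples each, computed with
separate hash functions. It holds `t * m` samples in total. -/
def multiSketch {n m t : ℕ} (L : ℕ) (h : Fin t → Hashes n L m)
    (a : EuclideanSpace ℝ (Fin n)) : Fin t → Sketch m :=
  fun r => sketch L (h r) a

/-- The median of the `t` estimates computed from corresponding pairs of sketches. -/
def multiEstimate {m t : ℕ} (L : ℕ) (A B : Fin t → Sketch m) : ℝ :=
  median fun r => estimate L (A r) (B r)

/-- The intersection of the supports of `a` and `b`. -/
def commonSupport {n : ℕ} (a b : EuclideanSpace ℝ (Fin n)) : Finset (Fin n) :=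
  Finset.univ.filter fun i => a i ≠ 0 ∧ b i ≠ 0

/-- The vector `a` restricted to the indices in `I` (other entries are set to `0`). -/
def restrict {n : ℕ} (I : Finset (Fin n)) (a : EuclideanSpace ℝ (Fin n)) :
    EuclideanSpace ℝ (Fin n) :=
  WithLp.toLp 2 fun i => if i ∈ I then a i else 0

end WMH

end

noncomputable section

namespace WMH

/-! Let `x`, `y` be the rounded normalisations of `a`, `b`, let `U` be the union of the nonzero
positions of the two extended vectors, and `u = |U|`, so that `L ≤ u ≤ 2 * L`. Let `M` be the larger
of `‖a_I‖ / ‖a‖` and `‖b_I‖ / ‖b‖`; the target error is `ε * ‖a‖ * ‖b‖ * M`.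

For one hash function, the smaller of the two stored hash values is the minimum of `u` independent
uniform variables: its mean is `1 / (u + 1)` and its standard deviation is no larger. The minimiser
is almost surely unique and uniform on `U`, and the summand of the estimate is a function of it
alone (`dependsOnArgmin_sampleValue`). Counting positions block by block, its mean is `L * ⟨x, y⟩ /
u` and its second moment is at most `(L / u) * ∑ i ∈ I, (x i ^ 2 + y i ^ 2) ≤ 4 * M ^ 2`
(`sum_ratio`, `sum_ratio_sq_le`).

Chebyshev then controls both sums over the `m` samples; a union bound suffices, so no independence
between the two sums is needed. On the good event `abs_estimate_sub_le` gives error `20 * η * M`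
against `⟨x, y⟩`, and rounding costs a further `3 * M * √(n ^ 2 / L)` (`abs_sum_mul_sub_le`). One
estimate thus fails with probability at most `1 / 16`, and the median of `t` of them with
probability at most `2⁻ᵗ`. -/

/-! ### Medians, majorities and Chebyshev's inequality on product spaces. -/

/-- If a middle order statistic is off by more than `r`, then so is everything on the outer side of
it, which is at least half of the values. The two conditions on `p` cover both middle positions. -/
theorem abs_sort_sub_le {t : ℕ} (x : Fin t → ℝ) (c r : ℝ)
    (h : 2 * (Finset.univ.filter fun i => r < |x i - c|).card < t) (p : Fin t)
    (hp₁ : (t - 1) / 2 ≤ (p : ℕ)) (hp₂ : (p : ℕ) ≤ t / 2) : |x (Tuple.sort x p) - c| ≤ r := by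
  by_contra! hp
  have hmono := Tuple.monotone_sort x
  have key : ∀ s : Finset (Fin t), (∀ q ∈ s, r < |x (Tuple.sort x q) - c|) → 2 * s.card < t := by
    intro s hs
    have : s.card ≤ (Finset.univ.filter fun i => r < |x i - c|).card := by
      apply Finset.card_le_card_of_injOn (Tuple.sort x)
      · intro q hq
        simpa using hs q hq
      · exact (Tuple.sort x).injective.injOn
    omega
  rcases lt_abs.1 hp with hp | hp
  · have := key (Finset.Ici p) (fun q hq => lt_abs.2 (Or.inl (by
      have : x (Tuple.sort x p) ≤ x (Tuple.sort x q) := hmono (Finset.mem_Ici.1 hq)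
      linarith)))
    rw [Fin.card_Ici] at this
    omega
  · have := key (Finset.Iic p) (fun q hq => lt_abs.2 (Or.inr (by
      have : x (Tuple.sort x q) ≤ x (Tuple.sort x p) := hmono (Finset.mem_Iic.1 hq)
      linarith)))
    rw [Fin.card_Iic] at this
    omega

theorem abs_median_sub_le {t : ℕ} (x : Fin t → ℝ) (c r : ℝ)
    (h : 2 * (Finset.univ.filter fun i => r < |x i - c|).card < t) : |median x - c| ≤ r := by
  have ht : 0 < t := by omega
  have h₁ := abs_sort_sub_le x c r h ⟨(t - 1) / 2, by omega⟩ le_rfl (by simp; omega)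
  have h₂ := abs_sort_sub_le x c r h ⟨t / 2, by omega⟩ (by simp; omega) le_rfl
  rw [median, dif_pos ht]
  rw [abs_le] at *
  constructor <;> linarith

/-- Union bound over at most `2 ^ t` sets `T`, each contributing at most `16⁻¹ ^ |T| = 4⁻¹ ^ (2 *
|T|) ≤ 4⁻¹ ^ t`. -/
theorem measure_pi_majority_le {Ω : Type*} [MeasurableSpace Ω] (μ : Measure Ω)
    [IsProbabilityMeasure μ] (F : Set Ω) (hF : μ F ≤ 1 / 16) (t : ℕ) :
    (Measure.pi fun _ : Fin t => μ) {h | ∃ T : Finset (Fin t), t ≤ 2 * T.card ∧ ∀ r ∈ T, h r ∈ F}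
      ≤ (1 / 2) ^ t := by
  have hsub : {h : Fin t → Ω | ∃ T : Finset (Fin t), t ≤ 2 * T.card ∧ ∀ r ∈ T, h r ∈ F} ⊆
      ⋃ T ∈ Finset.univ.filter (fun T : Finset (Fin t) => t ≤ 2 * T.card),
        (T : Set (Fin t)).pi fun _ => F := by
    rintro h ⟨T, hT, hr⟩
    simp only [Set.mem_iUnion]
    exact ⟨T, by simpa using hT, fun r hr' => hr r hr'⟩
  have hone : ∀ T ∈ Finset.univ.filter (fun T : Finset (Fin t) => t ≤ 2 * T.card),
      (Measure.pi fun _ : Fin t => μ) ((T : Set (Fin t)).pi fun _ => F) ≤ (1 / 4) ^ t := by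
    intro T hT
    rw [Measure.pi_pi_finset, Finset.prod_const]
    calc μ F ^ T.card ≤ (1 / 16) ^ T.card := by gcongr
      _ = (1 / 4) ^ (2 * T.card) := by
        rw [pow_mul, one_div, one_div, ← ENNReal.inv_pow, ← ENNReal.inv_pow, ← ENNReal.inv_pow]
        norm_num
      _ ≤ (1 / 4) ^ t := pow_le_pow_right_of_le_one' (by simp) (by simpa using hT)
  calc _ ≤ _ := measure_mono hsub
    _ ≤ ∑ T ∈ Finset.univ.filter (fun T : Finset (Fin t) => t ≤ 2 * T.card),
        (Measure.pi fun _ : Fin t => μ) ((T : Set (Fin t)).pi fun _ => F) :=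
      measure_biUnion_finset_le _ _
    _ ≤ ∑ T ∈ Finset.univ.filter (fun T : Finset (Fin t) => t ≤ 2 * T.card), (1 / 4) ^ t :=
      Finset.sum_le_sum hone
    _ ≤ ∑ T : Finset (Fin t), (1 / 4) ^ t :=
      Finset.sum_le_sum_of_subset (Finset.filter_subset _ _)
    _ = (1 / 2) ^ t := by
      rw [Finset.sum_const, Finset.card_univ, Fintype.card_finset, Fintype.card_fin, nsmul_eq_mul,
        Nat.cast_pow, ← mul_pow]
      congr 1
      rw [show (4 : ENNReal) = 2 * 2 by norm_num, one_div, one_div,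
        ENNReal.mul_inv (by simp) (by simp), ← mul_assoc]
      simp [ENNReal.mul_inv_cancel]

theorem measure_pi_lt_abs_sum_sub_le {Ω : Type*} [MeasurableSpace Ω] (μ : Measure Ω)
    [IsProbabilityMeasure μ] {f : Ω → ℝ} (hf : MemLp f 2 μ) {m : ℕ} {c p : ℝ} (hc : 0 ≤ c)
    (h : m * ProbabilityTheory.variance f μ ≤ p * c ^ 2) :
    (Measure.pi fun _ : Fin m => μ) {h | c < |∑ i, f (h i) - m * ∫ ω, f ω ∂μ|}
      ≤ ENNReal.ofReal p := by
  set ν := Measure.pi fun _ : Fin m => μ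
  have hfi : ∀ i : Fin m, MemLp (fun h : Fin m → Ω => f (h i)) 2 ν := fun i =>
    hf.comp_measurePreserving (measurePreserving_eval _ i)
  have hfe : ∀ i : Fin m, ∫ h, f (h i) ∂ν = ∫ ω, f ω ∂μ := fun i =>
    integral_comp_eval (μ := fun _ : Fin m => μ) hf.aestronglyMeasurable
  set S : (Fin m → Ω) → ℝ := ∑ i, fun h => f (h i) with hS
  have hSm : MemLp S 2 ν := memLp_finsetSum' _ fun i _ => hfi i
  have hSa : ∀ h, S h = ∑ i, f (h i) := fun h => by simp [hS]
  have hSe : ∫ h, S h ∂ν = m * ∫ ω, f ω ∂μ := by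
    simp_rw [hSa]
    rw [integral_finsetSum _ fun i _ => (hfi i).integrable (by norm_num)]
    simp [hfe]
  have hSv : ProbabilityTheory.variance S ν = m * ProbabilityTheory.variance f μ := by
    rw [hS, ProbabilityTheory.variance_sum_pi (μ := fun _ : Fin m => μ) (X := fun _ => f)
      fun _ => hf]
    simp
  simp_rw [← hSa, ← hSe]
  -- The case `c = 0` is needed for vectors with disjoint supports, where `M = 0`. The variance then
  -- vanishes and the sum is almost surely constant.
  rcases hc.eq_or_lt with rfl | hc
  · have h0 : ProbabilityTheory.variance S ν = 0 :=
      le_antisymm (by rw [hSv]; simpa using h) (ProbabilityTheory.variance_nonneg _ _)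
    have h1 : ProbabilityTheory.evariance S ν = 0 := by
      rw [← hSm.ofReal_variance_eq, h0, ENNReal.ofReal_zero]
    rw [ProbabilityTheory.evariance_eq_zero_iff hSm.aestronglyMeasurable.aemeasurable] at h1
    have : ν {h | 0 < |S h - ∫ h, S h ∂ν|} = 0 := by
      rw [measure_eq_zero_iff_ae_notMem]
      filter_upwards [h1] with x hx
      simp [hx]
    rw [this]
    exact zero_le
  · calc _ ≤ ν {h | c ≤ |S h - ∫ h, S h ∂ν|} := measure_mono (Set.ofPred_subset_ofPred.2 fun h hh => le_of_lt hh)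
      _ ≤ ENNReal.ofReal (ProbabilityTheory.variance S ν / c ^ 2) :=
        ProbabilityTheory.meas_ge_le_variance_div_sq hSm hc
      _ ≤ _ := by
        apply ENNReal.ofReal_le_ofReal
        rw [hSv, div_le_iff₀ (by positivity)]
        exact h

/-! ### Minimum and minimiser of independent uniform hash values. -/

section Uniform

variable {ι : Type*}

theorem inf'_coe_mem (U : Finset ι) (hU : U.Nonempty) (g : ι → unitInterval) :
    (U.inf' hU fun j => (g j : ℝ)) ∈ Set.Icc (0 : ℝ) 1 := by
  obtain ⟨j, hj⟩ := id hU
  exact ⟨(Finset.le_inf'_iff _ _).2 fun k _ => (g k).2.1,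
    (Finset.inf'_le _ hj).trans (g j).2.2⟩

/-- The event that `j` is the strict minimiser of the hash function over `U`. -/
def strictMinAt (U : Finset ι) (j : ι) : Set (ι → unitInterval) :=
  {g | ∀ k ∈ U, k ≠ j → g j < g k}

theorem measurableSet_strictMinAt (U : Finset ι) (j : ι) : MeasurableSet (strictMinAt U j) := by
  have : strictMinAt U j = ⋂ k ∈ U, ⋂ _ : k ≠ j, {g | g j < g k} := by
    ext g; simp [strictMinAt]
  rw [this]
  exact Finset.measurableSet_biInter _ fun k _ => MeasurableSet.iInter fun _ =>
    measurableSet_lt (measurable_pi_apply _) (measurable_pi_apply _)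

theorem disjoint_strictMinAt (U : Finset ι) {j k : ι} (hj : j ∈ U) (hk : k ∈ U) (hjk : j ≠ k) :
    Disjoint (strictMinAt U j) (strictMinAt U k) :=
  Set.disjoint_left.2 fun _ h₁ h₂ => lt_asymm (h₁ k hk hjk.symm) (h₂ j hj hjk)

theorem measurable_inf'_coe (U : Finset ι) (hU : U.Nonempty) :
    Measurable fun g : ι → unitInterval => U.inf' hU fun j => (g j : ℝ) :=
  measurable_of_Ioi fun s => by
    have : (fun g : ι → unitInterval => U.inf' hU fun j => (g j : ℝ)) ⁻¹' Set.Ioi s =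
        ⋂ j ∈ U, {g | s < (g j : ℝ)} := by
      ext g; simp
    rw [this]
    exact Finset.measurableSet_biInter _ fun j _ => measurableSet_lt measurable_const (by fun_prop)

variable [Fintype ι]

theorem volume_lt_inf' (U : Finset ι) (hU : U.Nonempty) {s : ℝ} (hs₀ : 0 ≤ s) (hs₁ : s ≤ 1) :
    (volume : Measure (ι → unitInterval)) {g | s < U.inf' hU fun j => (g j : ℝ)} =
      ENNReal.ofReal ((1 - s) ^ U.card) := by
  have : {g : ι → unitInterval | s < U.inf' hU fun j => (g j : ℝ)} =
      (U : Set ι).pi fun _ => Set.Ioi (⟨s, hs₀, hs₁⟩ : unitInterval) := by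
    ext g
    simp [Finset.lt_inf'_iff, Set.mem_pi, ← Subtype.coe_lt_coe]
  rw [this, volume_pi, Measure.pi_pi_finset]
  simp [unitInterval.volume_Ioi, ENNReal.ofReal_pow (sub_nonneg.2 hs₁)]

theorem volume_lt_inf'_of_one_le (U : Finset ι) (hU : U.Nonempty) {s : ℝ} (hs : 1 ≤ s) :
    (volume : Measure (ι → unitInterval)) {g | s < U.inf' hU fun j => (g j : ℝ)} = 0 := by
  have : {g : ι → unitInterval | s < U.inf' hU fun j => (g j : ℝ)} = ∅ := by
    ext g
    obtain ⟨j, hj⟩ := hU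
    simp only [Set.mem_ofPred_eq, Set.mem_empty_iff_false, iff_false, not_lt]
    exact (Finset.inf'_le _ hj).trans ((g j).2.2.trans hs)
  rw [this, measure_empty]

theorem memLp_inf'_coe (U : Finset ι) (hU : U.Nonempty) :
    MemLp (fun g : ι → unitInterval => U.inf' hU fun j => (g j : ℝ)) 2 volume :=
  MemLp.of_bound (measurable_inf'_coe U hU).aestronglyMeasurable 1 <| .of_forall fun g => by
    have := inf'_coe_mem U hU g
    rw [Real.norm_eq_abs, abs_of_nonneg this.1]
    exact this.2

/-- Layer-cake formula with the tail `P(min > s) = (1 - s) ^ |U|`. Taking `φ = 1` and `φ s = 2 * s`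
gives the first two moments. -/
theorem integral_intervalIntegral_inf' (U : Finset ι) (hU : U.Nonempty) {φ : ℝ → ℝ}
    (hφ : Continuous φ) (hφ₀ : ∀ s, 0 ≤ s → 0 ≤ φ s) :
    ∫ g : ι → unitInterval, (∫ s in 0..U.inf' hU fun j => (g j : ℝ), φ s) =
      ∫ s in (0 : ℝ)..1, (1 - s) ^ U.card * φ s := by
  have hX := fun g => inf'_coe_mem U hU g
  have h1 := lintegral_comp_eq_lintegral_meas_lt_mul
    (volume : Measure (ι → unitInterval)) (f := fun g => U.inf' hU fun j => (g j : ℝ)) (g := φ)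
    (.of_forall fun g => (hX g).1) (measurable_inf'_coe U hU).aemeasurable
    (fun t _ => hφ.intervalIntegrable 0 t)
    ((ae_restrict_iff' measurableSet_Ioi).2 (.of_forall fun s hs => hφ₀ s (le_of_lt hs)))
  have h2 : ∫⁻ s in Set.Ioi 0, (volume : Measure (ι → unitInterval))
        {g | s < U.inf' hU fun j => (g j : ℝ)} * ENNReal.ofReal (φ s) =
      ∫⁻ s in Set.Ioc 0 1, ENNReal.ofReal ((1 - s) ^ U.card * φ s) := by
    rw [← Set.Ioc_union_Ioi_eq_Ioi zero_le_one,
      lintegral_union measurableSet_Ioi (Set.Ioc_disjoint_Ioi le_rfl),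
      setLIntegral_congr_fun measurableSet_Ioi (g := fun _ => 0), lintegral_zero, add_zero]
    · refine setLIntegral_congr_fun measurableSet_Ioc fun s hs => ?_
      rw [volume_lt_inf' U hU hs.1.le hs.2,
        ENNReal.ofReal_mul (pow_nonneg (sub_nonneg.2 hs.2) _)]
    · intro s hs
      beta_reduce
      rw [volume_lt_inf'_of_one_le U hU (le_of_lt hs), zero_mul]
  rw [h2] at h1
  rw [integral_eq_lintegral_of_nonneg_ae, h1, intervalIntegral.integral_of_le zero_le_one,
    integral_eq_lintegral_of_nonneg_ae]
  · refine (ae_restrict_iff' measurableSet_Ioc).2 (.of_forall fun s hs => ?_)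
    exact mul_nonneg (pow_nonneg (sub_nonneg.2 hs.2) _) (hφ₀ s hs.1.le)
  · exact Continuous.aestronglyMeasurable (by fun_prop)
  · refine .of_forall fun g => ?_
    exact intervalIntegral.integral_nonneg (hX g).1 fun s hs => hφ₀ s hs.1
  · refine Measurable.aestronglyMeasurable ?_
    exact (intervalIntegral.continuous_primitive
      (fun a b => hφ.intervalIntegrable a b) 0).measurable.comp (measurable_inf'_coe U hU)

theorem integral_inf'_coe (U : Finset ι) (hU : U.Nonempty) :
    ∫ g : ι → unitInterval, (U.inf' hU fun j => (g j : ℝ)) = 1 / (U.card + 1) := by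
  have := integral_intervalIntegral_inf' U hU (φ := fun _ => 1) continuous_const (by simp)
  simp only [intervalIntegral.integral_const, smul_eq_mul, mul_one, sub_zero] at this
  rw [this, intervalIntegral.integral_comp_sub_left (fun s => s ^ U.card)]
  simp

theorem integral_inf'_coe_sq (U : Finset ι) (hU : U.Nonempty) :
    ∫ g : ι → unitInterval, (U.inf' hU fun j => (g j : ℝ)) ^ 2 =
      2 / ((U.card + 1) * (U.card + 2)) := by
  have := integral_intervalIntegral_inf' U hU (φ := fun s => 2 * s) (by fun_prop)
    (fun s hs => by positivity)
  have h3 : ∀ x : ℝ, ∫ s in (0 : ℝ)..x, 2 * s = x ^ 2 := fun x => by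
    rw [intervalIntegral.integral_const_mul, integral_id]; ring
  simp only [h3] at this
  -- In the variable `r = 1 - s` the integrand is a difference of two monomials.
  have h2 : ∀ s : ℝ, (1 - s) ^ U.card * (2 * s) =
      (fun r => 2 * r ^ U.card - 2 * r ^ (U.card + 1)) (1 - s) := fun s => by ring
  simp_rw [h2] at this
  rw [intervalIntegral.integral_comp_sub_left (fun r : ℝ => 2 * r ^ U.card - 2 * r ^ (U.card + 1)),
    intervalIntegral.integral_sub
      (Continuous.intervalIntegrable (by fun_prop) _ _)
      (Continuous.intervalIntegrable (by fun_prop) _ _)] at this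
  simp only [intervalIntegral.integral_const_mul, integral_pow] at this
  rw [this]
  push_cast
  simp only [sub_zero, sub_self, one_pow, zero_pow (Nat.succ_ne_zero _)]
  field_simp
  ring

theorem variance_inf'_coe_le (U : Finset ι) (hU : U.Nonempty) :
    ProbabilityTheory.variance (fun g : ι → unitInterval => U.inf' hU fun j => (g j : ℝ)) volume ≤
      (1 / ((U.card : ℝ) + 1)) ^ 2 := by
  rw [ProbabilityTheory.variance_eq_sub (memLp_inf'_coe U hU)]
  simp only [Pi.pow_apply]
  rw [integral_inf'_coe, integral_inf'_coe_sq]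
  have : (0 : ℝ) ≤ U.card := by positivity
  rw [sub_le_iff_le_add, div_pow, one_pow, ← add_div, div_le_div_iff₀ (by positivity) (by positivity)]
  nlinarith

/-- The two coordinates are independent and their law has no atoms, so Fubini makes the diagonal
null. Hence ties, and the rule that breaks them, do not matter. -/
theorem volume_eval_eq_eval {j k : ι} (hjk : j ≠ k) :
    (volume : Measure (ι → unitInterval)) {g | g j = g k} = 0 := by
  have hind := (ProbabilityTheory.iIndepFun_pi (μ := fun _ : ι => (volume : Measure unitInterval))
    (X := fun _ x => x) (fun _ => aemeasurable_id)).indepFun hjk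
  have hmap := (ProbabilityTheory.indepFun_iff_map_prod_eq_prod_map_map
    (measurable_pi_apply j).aemeasurable (measurable_pi_apply k).aemeasurable).1 hind
  have he : ∀ i : ι, Measure.map (fun g : ι → unitInterval => g i)
      (Measure.pi fun _ : ι => (volume : Measure unitInterval)) = volume := fun i =>
    (measurePreserving_eval (fun _ : ι => (volume : Measure unitInterval)) i).map_eq
  rw [he, he] at hmap
  have hdiag : MeasurableSet {p : unitInterval × unitInterval | p.1 = p.2} :=
    measurableSet_eq_fun measurable_fst measurable_snd
  have : (volume : Measure (ι → unitInterval)) {g | g j = g k} =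
      Measure.map (fun g : ι → unitInterval => (g j, g k)) (Measure.pi fun _ => volume)
        {p : unitInterval × unitInterval | p.1 = p.2} := by
    rw [Measure.map_apply (by fun_prop) hdiag]
    rfl
  rw [this, hmap, Measure.measure_prod_null hdiag]
  refine .of_forall fun x => ?_
  have : Prod.mk x ⁻¹' {p : unitInterval × unitInterval | p.1 = p.2} = {x} := by
    ext y; simp [eq_comm]
  simp [this]

theorem ae_injective_of_finite :
    ∀ᵐ g ∂(volume : Measure (ι → unitInterval)), Function.Injective g := by
  have : ∀ p : ι × ι, ∀ᵐ g ∂(volume : Measure (ι → unitInterval)), p.1 ≠ p.2 → g p.1 ≠ g p.2 := by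
    rintro ⟨j, k⟩
    by_cases hjk : j = k
    · simp [hjk]
    · have := volume_eval_eq_eval hjk
      rw [measure_eq_zero_iff_ae_notMem] at this
      filter_upwards [this] with g hg _ using hg
  filter_upwards [ae_all_iff.2 this] with g hg j k hjk
  by_contra hne
  exact hg (j, k) hne hjk

/-- Swapping coordinates `j` and `k` preserves the product measure and exchanges the two events. -/
theorem volume_strictMinAt_eq (U : Finset ι) {j k : ι} (hj : j ∈ U) (hk : k ∈ U) :
    (volume : Measure (ι → unitInterval)) (strictMinAt U j) = volume (strictMinAt U k) := by
  classical
  have hmp := volume_measurePreserving_piCongrLeft (fun _ : ι => unitInterval) (Equiv.swap j k)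
  have hpre : (MeasurableEquiv.piCongrLeft (fun _ : ι => unitInterval) (Equiv.swap j k)) ⁻¹'
      strictMinAt U k = strictMinAt U j := by
    have happ : ∀ (g : ι → unitInterval) (i : ι), MeasurableEquiv.piCongrLeft
        (fun _ : ι => unitInterval) (Equiv.swap j k) g i = g (Equiv.swap j k i) := by
      intro g i
      have := MeasurableEquiv.piCongrLeft_apply_apply (β := fun _ : ι => unitInterval)
        (e := Equiv.swap j k) g (Equiv.swap j k i)
      rwa [Equiv.swap_apply_self] at this
    have hU : ∀ i, Equiv.swap j k i ∈ U ↔ i ∈ U := by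
      intro i
      rcases eq_or_ne i j with rfl | hij
      · simp [hj, hk]
      rcases eq_or_ne i k with rfl | hik
      · simp [hj, hk]
      rw [Equiv.swap_apply_of_ne_of_ne hij hik]
    ext g
    simp only [strictMinAt, Set.mem_preimage, Set.mem_ofPred_eq, happ, Equiv.swap_apply_right]
    constructor
    · intro h i hi hij
      have := h (Equiv.swap j k i) ((hU i).2 hi) (fun h' => hij (by
        rw [← Equiv.swap_apply_self j k i, h', Equiv.swap_apply_right]))
      rwa [Equiv.swap_apply_self] at this
    · intro h i hi hik
      exact h _ ((hU i).2 hi) (fun h' => hik (by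
        rw [← Equiv.swap_apply_self j k i, h', Equiv.swap_apply_left]))
  rw [← hpre, hmp.measure_preimage (measurableSet_strictMinAt U k).nullMeasurableSet]

theorem ae_exists_strictMinAt (U : Finset ι) (hU : U.Nonempty) :
    ∀ᵐ g ∂(volume : Measure (ι → unitInterval)), ∃ j ∈ U, g ∈ strictMinAt U j := by
  filter_upwards [ae_injective_of_finite] with g hg
  obtain ⟨j, hj, hmin⟩ := U.exists_min_image g hU
  exact ⟨j, hj, fun k hk hkj => lt_of_le_of_ne (hmin k hk) (fun h => hkj (hg h).symm)⟩

/-- The events for the different elements of `U` are disjoint, equally likely, and cover almost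
everything. -/
theorem volume_real_strictMinAt (U : Finset ι) {j : ι} (hj : j ∈ U) :
    (volume : Measure (ι → unitInterval)).real (strictMinAt U j) = 1 / U.card := by
  have hU : U.Nonempty := ⟨j, hj⟩
  have h1 : (volume : Measure (ι → unitInterval)).real (⋃ k ∈ U, strictMinAt U k) = 1 := by
    rw [← probReal_univ (μ := (volume : Measure (ι → unitInterval)))]
    refine measureReal_congr (Filter.eventuallyEq_univ.2 ?_)
    filter_upwards [ae_exists_strictMinAt U hU] with g hg
    simpa using hg
  rw [measureReal_biUnion_finset
    (fun a ha b hb hab => disjoint_strictMinAt U ha hb hab)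
    (fun k _ => measurableSet_strictMinAt U k),
    Finset.sum_congr rfl fun k hk => show (volume : Measure (ι → unitInterval)).real
      (strictMinAt U k) = (volume : Measure (ι → unitInterval)).real
      (strictMinAt U j) from congrArg ENNReal.toReal (volume_strictMinAt_eq U hk hj),
    Finset.sum_const, nsmul_eq_mul] at h1
  have : (U.card : ℝ) ≠ 0 := by exact_mod_cast hU.card_ne_zero
  field_simp
  linarith

/-- A function which depends only on the minimiser of the hash function over `U`. -/
structure DependsOnArgmin (U : Finset ι) (w : ι → ℝ) (f : (ι → unitInterval) → ℝ) : Prop where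
  eq_of_mem : ∀ j ∈ U, ∀ g ∈ strictMinAt U j, f g = w j

theorem DependsOnArgmin.ae_eq {U : Finset ι} (hU : U.Nonempty) {w : ι → ℝ}
    {f : (ι → unitInterval) → ℝ} (hf : DependsOnArgmin U w f) :
    f =ᵐ[volume] fun g => ∑ j ∈ U, (strictMinAt U j).indicator (fun _ => w j) g := by
  filter_upwards [ae_exists_strictMinAt U hU] with g ⟨j, hj, hg⟩
  rw [hf.eq_of_mem j hj g hg, Finset.sum_eq_single_of_mem j hj, Set.indicator_of_mem hg]
  intro k hk hkj
  exact Set.indicator_of_notMem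
    (fun h => Set.disjoint_left.1 (disjoint_strictMinAt U hk hj hkj) h hg) _

theorem DependsOnArgmin.memLp {U : Finset ι} (hU : U.Nonempty) {w : ι → ℝ}
    {f : (ι → unitInterval) → ℝ} (hf : DependsOnArgmin U w f) : MemLp f 2 volume :=
  (memLp_congr_ae (hf.ae_eq hU)).2 <| memLp_finsetSum _ fun j _ =>
    memLp_indicator_const _ (measurableSet_strictMinAt U j) _ (Or.inr (measure_ne_top _ _))

theorem DependsOnArgmin.integral_eq {U : Finset ι} (hU : U.Nonempty) {w : ι → ℝ}
    {f : (ι → unitInterval) → ℝ} (hf : DependsOnArgmin U w f) :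
    ∫ g, f g = (∑ j ∈ U, w j) / U.card := by
  rw [integral_congr_ae (hf.ae_eq hU), integral_finsetSum _ fun j _ =>
    (integrable_const (w j)).indicator (measurableSet_strictMinAt U j), Finset.sum_div]
  refine Finset.sum_congr rfl fun j hj => ?_
  rw [integral_indicator_const _ (measurableSet_strictMinAt U j), volume_real_strictMinAt U hj,
    smul_eq_mul]
  ring

theorem DependsOnArgmin.variance_le {U : Finset ι} (hU : U.Nonempty) {w : ι → ℝ}
    {f : (ι → unitInterval) → ℝ} (hf : DependsOnArgmin U w f) :
    ProbabilityTheory.variance f volume ≤ (∑ j ∈ U, w j ^ 2) / U.card := by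
  have h2 : DependsOnArgmin U (fun j => w j ^ 2) (f ^ 2) :=
    ⟨fun j hj g hg => by simp [hf.eq_of_mem j hj g hg]⟩
  rw [ProbabilityTheory.variance_eq_sub (hf.memLp hU), h2.integral_eq hU]
  exact sub_le_self _ (sq_nonneg _)

end Uniform

/-! ### Rounding a unit vector to squares in `ℕ / L`. -/

section Rounding

variable {n : ℕ}

theorem mul_sign_mul_nonneg (x : ℝ) {s : ℝ} (hs : 0 ≤ s) : 0 ≤ Real.sign x * s * x := by
  rcases lt_trichotomy x 0 with h | rfl | h
  · rw [Real.sign_of_neg h]; nlinarith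
  · simp
  · rw [Real.sign_of_pos h]; positivity

theorem sign_mul_sqrt_sq {x s : ℝ} (hx : x ≠ 0) (hs : 0 ≤ s) : (Real.sign x * √s) ^ 2 = s := by
  rw [mul_pow, Real.sq_sqrt hs]
  rcases Real.sign_apply_eq_of_ne_zero x hx with h | h <;> simp [h]

theorem roundDown_sq (L : ℕ) (z : EuclideanSpace ℝ (Fin n)) (i : Fin n) :
    roundDown L z i ^ 2 = (⌊z i ^ 2 * L⌋₊ : ℝ) / L := by
  have hq : ((⌊z i ^ 2 * L⌋ : ℤ) : ℝ) = (⌊z i ^ 2 * L⌋₊ : ℝ) :=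
    (natCast_floor_eq_intCast_floor (by positivity)).symm
  change (Real.sign (z i) * √((⌊z i ^ 2 * L⌋ : ℝ) / L)) ^ 2 = _
  rw [hq]
  rcases eq_or_ne (z i) 0 with h | h
  · simp [h]
  · exact sign_mul_sqrt_sq h (by positivity)

/-- The properties of the rounding `x` of a unit vector `z` which the analysis relies on:
the scaled squares of the entries of `x` are natural numbers with sum `L`, the signs agree with
those of `z`, and the squares are close to those of `z`. -/
structure IsRounding (L : ℕ) (z x : EuclideanSpace ℝ (Fin n)) (k : Fin n → ℕ) : Prop where
  sq_mul : ∀ i, x i ^ 2 * L = k i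
  sum_eq : ∑ i, k i = L
  mul_nonneg : ∀ i, 0 ≤ x i * z i
  abs_sq_sub_le : ∀ i, |x i ^ 2 - z i ^ 2| ≤ n / L
  sq_le : ∀ i, x i ^ 2 ≤ 2 * z i ^ 2

theorem exists_isRounding_round {L : ℕ} (hL : 0 < L) (hn : n ^ 2 ≤ L)
    {z : EuclideanSpace ℝ (Fin n)} (hz : ‖z‖ = 1) : ∃ k, IsRounding L z (round L z) k := by
  have hL' : (0 : ℝ) < L := by exact_mod_cast hL
  have hz2 : ∑ i, z i ^ 2 = 1 := by rw [← EuclideanSpace.real_norm_sq_eq, hz, one_pow]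
  have hne : (Finset.univ : Finset (Fin n)).Nonempty := by
    by_contra h
    rw [Finset.not_nonempty_iff_eq_empty] at h
    simp [h] at hz2
  obtain ⟨j, hj, -, hmax⟩ := firstArgmin_isSome Finset.univ (fun k => -|z k|) hne
  simp only [Finset.mem_univ, neg_le_neg_iff, forall_true_left] at hmax
  set q : Fin n → ℕ := fun i => ⌊z i ^ 2 * L⌋₊ with hq
  have hq₁ : ∀ i, (q i : ℝ) ≤ z i ^ 2 * L := fun i => Nat.floor_le (by positivity)
  have hq₂ : ∀ i, z i ^ 2 * L < q i + 1 := fun i => Nat.lt_floor_add_one _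
  have hzL : ∑ i, z i ^ 2 * L = L := by rw [← Finset.sum_mul, hz2, one_mul]
  have hqL : ((∑ i, q i : ℕ) : ℝ) ≤ L := by
    rw [← hzL]; push_cast; exact Finset.sum_le_sum fun i _ => hq₁ i
  have hqL' : ∑ i, q i ≤ L := by exact_mod_cast hqL
  have hqL₂ : (L : ℝ) ≤ (∑ i, q i : ℕ) + n := by
    conv_lhs => rw [← hzL]
    push_cast
    calc ∑ i, z i ^ 2 * L ≤ ∑ i, ((q i : ℝ) + 1) := Finset.sum_le_sum fun i _ => (hq₂ i).le
      _ = _ := by simp [Finset.sum_add_distrib]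
  have hn1 : 1 ≤ n := Nat.one_le_iff_ne_zero.2 (by rintro rfl; simp at hz2)
  have hn1' : (1 : ℝ) ≤ n := by exact_mod_cast hn1
  -- The largest of `n` squares with sum `1` is at least `1 / n`. This lets entry `j` absorb the
  -- missing mass, which is at most `n / L`.
  have hjn : 1 ≤ n * z j ^ 2 := by
    rw [← hz2]
    calc ∑ i, z i ^ 2 ≤ ∑ _i : Fin n, z j ^ 2 :=
          Finset.sum_le_sum fun i _ => sq_le_sq.2 (hmax i)
      _ = _ := by simp
  have hzj : z j ≠ 0 := by rintro h; norm_num [h] at hjn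
  have hnorm : 1 - ‖roundDown L z‖ ^ 2 = ((L - ∑ i, q i : ℕ) : ℝ) / L := by
    rw [EuclideanSpace.real_norm_sq_eq]
    simp_rw [roundDown_sq]
    rw [← Finset.sum_div, Nat.cast_sub hqL', sub_div, div_self hL'.ne']
    push_cast
    rfl
  set k : Fin n → ℕ := fun i => q i + if i = j then L - ∑ i, q i else 0 with hk
  have hsq : ∀ i, round L z i ^ 2 = k i / L := by
    intro i
    change (if firstArgmin Finset.univ (fun k => -|z k|) = some i then _ else _) ^ 2 = _
    rw [hj, hnorm]
    by_cases hij : i = j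
    · subst hij
      rw [if_pos rfl, sign_mul_sqrt_sq hzj (by positivity), roundDown_sq]
      simp [hk, hq, add_div]
    · rw [if_neg (by simpa using Ne.symm hij), roundDown_sq]
      simp [hk, hq, hij]
  have hk₁ : ∀ i, z i ^ 2 * L ≤ k i + 1 := fun i => by
    have : (q i : ℝ) ≤ k i := by exact_mod_cast Nat.le_add_right _ _
    linarith [hq₂ i]
  have hk₂ : ∀ i, (k i : ℝ) ≤ z i ^ 2 * L + if i = j then (n : ℝ) else 0 := by
    intro i
    have := hq₁ i
    by_cases hij : i = j
    · simp only [hk, if_pos hij]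
      push_cast [Nat.cast_sub hqL'] at hqL₂ ⊢
      linarith
    · simpa [hk, hij] using this
  refine ⟨k, ?_, ?_, ?_, ?_, ?_⟩
  · intro i
    rw [hsq]
    field_simp
  · simp only [hk]
    rw [Finset.sum_add_distrib, Finset.sum_ite_eq' Finset.univ j]
    simp only [Finset.mem_univ, if_true]
    omega
  · intro i
    change 0 ≤ (if firstArgmin Finset.univ (fun k => -|z k|) = some i then
      Real.sign (z i) * √(roundDown L z i ^ 2 + (1 - ‖roundDown L z‖ ^ 2))
      else Real.sign (z i) * √((⌊z i ^ 2 * L⌋ : ℝ) / L)) * z i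
    split_ifs <;> exact mul_sign_mul_nonneg _ (Real.sqrt_nonneg _)
  · intro i
    rw [hsq, abs_le]
    have h1 := hk₁ i
    have h2 : (k i : ℝ) ≤ z i ^ 2 * L + n :=
      (hk₂ i).trans (by split_ifs <;> linarith)
    constructor
    · rw [neg_le_sub_iff_le_add, ← add_div, le_div_iff₀ hL']
      linarith
    · rw [sub_le_iff_le_add, div_le_iff₀ hL', add_mul, div_mul_cancel₀ _ hL'.ne']
      linarith
  -- Only entry `j` can grow, by at most `n / L ≤ n ^ 2 * z j ^ 2 / L ≤ z j ^ 2`; this is where `n ^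
  -- 2 ≤ L` enters.
  · intro i
    rw [hsq, div_le_iff₀ hL']
    refine (hk₂ i).trans ?_
    split_ifs with hij
    · subst hij
      have : (n : ℝ) ^ 2 ≤ L := by exact_mod_cast hn
      have : (n : ℝ) ≤ z i ^ 2 * L := by
        calc (n : ℝ) ≤ n * (n * z i ^ 2) := le_mul_of_one_le_right (by positivity) hjn
          _ = z i ^ 2 * n ^ 2 := by ring
          _ ≤ _ := by gcongr
      linarith
    · nlinarith [mul_nonneg (sq_nonneg (z i)) hL'.le]

/-- Agreement of signs gives `|x i - z i| ≤ |x i + z i|`, so the squared difference is bounded by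
the difference of squares. -/
theorem IsRounding.sq_sub_le {L : ℕ} {z x : EuclideanSpace ℝ (Fin n)} {k : Fin n → ℕ}
    (h : IsRounding L z x k) (i : Fin n) : (x i - z i) ^ 2 ≤ n / L := by
  refine le_trans ?_ (h.abs_sq_sub_le i)
  have h0 := h.mul_nonneg i
  have : |x i - z i| ≤ |x i + z i| := sq_le_sq.1 (by nlinarith)
  calc (x i - z i) ^ 2 = |x i - z i| * |x i - z i| := by rw [← sq, sq_abs]
    _ ≤ |x i - z i| * |x i + z i| := by gcongr
    _ = |x i ^ 2 - z i ^ 2| := by rw [← abs_mul]; congr 1; ring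

theorem sum_mul_sq_le_of_sq_le (I : Finset (Fin n)) (f g : Fin n → ℝ) {F G : ℝ} (hF : 0 ≤ F)
    (hG : 0 ≤ G) (hf : ∑ i ∈ I, f i ^ 2 ≤ F ^ 2) (hg : ∑ i ∈ I, g i ^ 2 ≤ G ^ 2) :
    |∑ i ∈ I, f i * g i| ≤ F * G := by
  apply abs_le_of_sq_le_sq _ (by positivity)
  refine (Finset.sum_mul_sq_le_sq_mul_sq I f g).trans ?_
  rw [mul_pow]
  gcongr

/-- The effect of rounding on the part of an inner product supported on `I`. -/
theorem abs_sum_mul_sub_le {L : ℕ} (hL : 0 < L) {z w x y : EuclideanSpace ℝ (Fin n)}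
    {k l : Fin n → ℕ} (hx : IsRounding L z x k) (hy : IsRounding L w y l) (I : Finset (Fin n))
    {M : ℝ} (hM : 0 ≤ M) (hz : ∑ i ∈ I, z i ^ 2 ≤ M ^ 2) (hw : ∑ i ∈ I, w i ^ 2 ≤ M ^ 2) :
    |∑ i ∈ I, x i * y i - ∑ i ∈ I, z i * w i| ≤ 3 * M * √(n ^ 2 / L) := by
  have hL' : (0 : ℝ) < L := by exact_mod_cast hL
  have hd : ∀ {z x : EuclideanSpace ℝ (Fin n)} {k : Fin n → ℕ}, IsRounding L z x k →
      ∑ i ∈ I, (x i - z i) ^ 2 ≤ √(n ^ 2 / L) ^ 2 := by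
    intro z x k h
    rw [Real.sq_sqrt (by positivity)]
    calc ∑ i ∈ I, (x i - z i) ^ 2 ≤ ∑ i, (x i - z i) ^ 2 :=
          Finset.sum_le_sum_of_subset_of_nonneg (Finset.subset_univ _) fun _ _ _ => sq_nonneg _
      _ ≤ ∑ _i : Fin n, (n : ℝ) / L := Finset.sum_le_sum fun i _ => h.sq_sub_le i
      _ = _ := by simp; ring
  have hy2 : ∑ i ∈ I, y i ^ 2 ≤ (2 * M) ^ 2 := by
    calc ∑ i ∈ I, y i ^ 2 ≤ ∑ i ∈ I, 2 * w i ^ 2 := Finset.sum_le_sum fun i _ => hy.sq_le i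
      _ ≤ _ := by rw [← Finset.mul_sum]; nlinarith
  have h1 := sum_mul_sq_le_of_sq_le I (fun i => x i - z i) y (Real.sqrt_nonneg _) (by positivity)
    (hd hx) hy2
  have h2 := sum_mul_sq_le_of_sq_le I z (fun i => y i - w i) hM (Real.sqrt_nonneg _) hz (hd hy)
  -- Cauchy–Schwarz on each part gives `√(n ^ 2 / L)` times `2 * M` and times `M`. Staying inside
  -- `I` is what makes the error proportional to `M`.
  have h3 : ∑ i ∈ I, x i * y i - ∑ i ∈ I, z i * w i =
      ∑ i ∈ I, (x i - z i) * y i + ∑ i ∈ I, z i * (y i - w i) := by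
    rw [← Finset.sum_sub_distrib, ← Finset.sum_add_distrib]
    exact Finset.sum_congr rfl fun i _ => by ring
  rw [h3]
  refine (abs_add_le _ _).trans ?_
  linarith

end Rounding

/-! ### Counting positions of the extended vectors. -/

section Extension

variable {n L : ℕ}

theorem sum_fin_mul_eq (f : Fin n → ℝ) (c : Fin n → ℕ) (hc : ∀ i, c i ≤ L) :
    ∑ j : Fin (n * L), (if (j.modNat : ℕ) < c j.divNat then f j.divNat else 0) =
      ∑ i, c i * f i := by
  have h := finProdFinEquiv.symm.sum_comp
    (fun p : Fin n × Fin L => if (p.2 : ℕ) < c p.1 then f p.1 else 0)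
  simp only [finProdFinEquiv_symm_apply] at h
  rw [h, Fintype.sum_prod_type]
  refine Finset.sum_congr rfl fun i _ => ?_
  dsimp only
  rw [← Finset.sum_filter, Finset.sum_const, nsmul_eq_mul]
  congr 2
  rw [Fin.card_filter_val_lt, min_eq_right (hc i)]

theorem IsRounding.le {z x : EuclideanSpace ℝ (Fin n)} {k : Fin n → ℕ}
    (h : IsRounding L z x k) (i : Fin n) : k i ≤ L :=
  h.sum_eq ▸ Finset.single_le_sum (fun _ _ => Nat.zero_le _) (Finset.mem_univ i)

theorem IsRounding.eq_zero_iff {z x : EuclideanSpace ℝ (Fin n)} {k : Fin n → ℕ} (hL : 0 < L)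
    (h : IsRounding L z x k) (i : Fin n) : k i = 0 ↔ x i = 0 := by
  have hL' : (L : ℝ) ≠ 0 := by exact_mod_cast hL.ne'
  rw [← Nat.cast_eq_zero (R := ℝ), ← h.sq_mul]
  simp [hL']

theorem extend_eq {a z : EuclideanSpace ℝ (Fin n)} {k : Fin n → ℕ}
    (h : IsRounding L z (normRound L a) k) (j : Fin (n * L)) :
    extend L a j = if (j.modNat : ℕ) < k j.divNat then normRound L a j.divNat else 0 := by
  rw [extend, h.sq_mul]
  simp only [Nat.cast_lt]

theorem extend_ne_zero_iff {a z : EuclideanSpace ℝ (Fin n)} {k : Fin n → ℕ} (hL : 0 < L)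
    (h : IsRounding L z (normRound L a) k) (j : Fin (n * L)) :
    extend L a j ≠ 0 ↔ (j.modNat : ℕ) < k j.divNat := by
  rw [extend_eq h]
  split_ifs with hj
  · exact iff_of_true (mt (h.eq_zero_iff hL _).2 (Nat.zero_le _ |>.trans_lt hj).ne') hj
  · exact iff_of_false (not_not.2 rfl) hj

/-- The positions of the nonzero entries of the extended vector. -/
def positions (L : ℕ) (a : EuclideanSpace ℝ (Fin n)) : Finset (Fin (n * L)) :=
  Finset.univ.filter fun j => extend L a j ≠ 0

theorem mem_positions {a : EuclideanSpace ℝ (Fin n)} {j : Fin (n * L)} :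
    j ∈ positions L a ↔ extend L a j ≠ 0 := by
  simp [positions]

theorem card_positions {a z : EuclideanSpace ℝ (Fin n)} {k : Fin n → ℕ} (hL : 0 < L)
    (h : IsRounding L z (normRound L a) k) : (positions L a).card = L := by
  have h1 := sum_fin_mul_eq (fun _ => 1) k h.le
  rw [← Finset.sum_filter, Finset.sum_const, nsmul_eq_mul] at h1
  simp only [mul_one, ← Nat.cast_sum, h.sum_eq] at h1
  simp only [positions, extend_ne_zero_iff hL h]
  exact_mod_cast h1

/-- The value contributed to the estimate by a sample that selects position `j`. -/
def ratio (L : ℕ) (a b : EuclideanSpace ℝ (Fin n)) (j : Fin (n * L)) : ℝ :=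
  extend L a j * extend L b j / min (extend L a j ^ 2) (extend L b j ^ 2)

theorem ratio_eq {a b z w : EuclideanSpace ℝ (Fin n)} {k l : Fin n → ℕ}
    (hk : IsRounding L z (normRound L a) k) (hl : IsRounding L w (normRound L b) l)
    (j : Fin (n * L)) :
    ratio L a b j = if (j.modNat : ℕ) < min (k j.divNat) (l j.divNat) then
      normRound L a j.divNat * normRound L b j.divNat /
        min (normRound L a j.divNat ^ 2) (normRound L b j.divNat ^ 2) else 0 := by
  rw [ratio, extend_eq hk, extend_eq hl]
  generalize (j.modNat : ℕ) = o
  by_cases h1 : o < k j.divNat <;> by_cases h2 : o < l j.divNat <;> simp [h1, h2]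

theorem cast_min_eq {z w x y : EuclideanSpace ℝ (Fin n)} {k l : Fin n → ℕ}
    (hk : IsRounding L z x k) (hl : IsRounding L w y l) (i : Fin n) :
    ((min (k i) (l i) : ℕ) : ℝ) = min (x i ^ 2) (y i ^ 2) * L := by
  rw [Nat.cast_min, ← hk.sq_mul, ← hl.sq_mul, min_mul_of_nonneg _ _ (Nat.cast_nonneg L)]

/-- Nonzero entries fill an initial segment of each block, so block `i` has `min (x i ^ 2) (y i ^ 2)
* L` shared positions. This count cancels the denominator of the ratio. -/
theorem sum_ratio {a b z w : EuclideanSpace ℝ (Fin n)} {k l : Fin n → ℕ}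
    (hk : IsRounding L z (normRound L a) k) (hl : IsRounding L w (normRound L b) l) :
    ∑ j, ratio L a b j = L * ∑ i, normRound L a i * normRound L b i := by
  simp_rw [ratio_eq hk hl]
  rw [sum_fin_mul_eq (fun i => normRound L a i * normRound L b i /
    min (normRound L a i ^ 2) (normRound L b i ^ 2)) (fun i => min (k i) (l i))
    fun i => (min_le_left _ _).trans (hk.le i), Finset.mul_sum]
  refine Finset.sum_congr rfl fun i _ => ?_
  rw [cast_min_eq hk hl]
  set x := normRound L a i
  set y := normRound L b i
  by_cases hx : x = 0
  · simp [hx]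
  by_cases hy : y = 0
  · simp [hy]
  have : min (x ^ 2) (y ^ 2) ≠ 0 := (lt_min (by positivity) (by positivity)).ne'
  field_simp

/-- After the same count one denominator survives, and block `i` contributes `L * x i ^ 2 * y i ^ 2
/ min = L * max (x i ^ 2) (y i ^ 2)`. The restriction to `I` is the source of the improved error
bound. -/
theorem sum_ratio_sq_le {a b z w : EuclideanSpace ℝ (Fin n)} {k l : Fin n → ℕ}
    (hk : IsRounding L z (normRound L a) k) (hl : IsRounding L w (normRound L b) l)
    (I : Finset (Fin n)) (hI : ∀ i, i ∉ I → normRound L a i * normRound L b i = 0) :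
    ∑ j, ratio L a b j ^ 2 ≤ L * ∑ i ∈ I, (normRound L a i ^ 2 + normRound L b i ^ 2) := by
  have h1 : ∀ j, ratio L a b j ^ 2 = if (j.modNat : ℕ) < min (k j.divNat) (l j.divNat) then
      (normRound L a j.divNat * normRound L b j.divNat /
        min (normRound L a j.divNat ^ 2) (normRound L b j.divNat ^ 2)) ^ 2 else 0 := by
    intro j
    rw [ratio_eq hk hl]
    split_ifs <;> simp
  simp_rw [h1]
  rw [sum_fin_mul_eq (fun i => (normRound L a i * normRound L b i /
    min (normRound L a i ^ 2) (normRound L b i ^ 2)) ^ 2) (fun i => min (k i) (l i))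
    fun i => (min_le_left _ _).trans (hk.le i), Finset.mul_sum,
    ← Finset.sum_subset (Finset.subset_univ I) fun i _ hi => by simp [hI i hi]]
  refine Finset.sum_le_sum fun i _ => ?_
  rw [cast_min_eq hk hl]
  set x := normRound L a i
  set y := normRound L b i
  by_cases hx : x = 0
  · simp [hx]; positivity
  by_cases hy : y = 0
  · simp [hy]; positivity
  have hm : min (x ^ 2) (y ^ 2) ≠ 0 := (lt_min (by positivity) (by positivity)).ne'
  have h2 : min (x ^ 2) (y ^ 2) * L * (x * y / min (x ^ 2) (y ^ 2)) ^ 2 =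
      L * (x ^ 2 * y ^ 2 / min (x ^ 2) (y ^ 2)) := by
    field_simp
  rw [h2, ← min_mul_max (x ^ 2) (y ^ 2), mul_div_cancel_left₀ _ hm]
  gcongr
  exact max_le (by linarith [sq_nonneg y]) (by linarith [sq_nonneg x])

end Extension

/-! ### One sample as a function of the minimiser over the union. -/

section Sample

variable {n L : ℕ}

/-- The hash value stored in the sketch of `a` for the hash function `g`. -/
def minHash (L : ℕ) (a : EuclideanSpace ℝ (Fin n)) (g : Fin (n * L) → unitInterval) : ℝ :=
  (selected L a g).elim 0 fun j => (g j : ℝ)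

/-- The value stored in the sketch of `a` for the hash function `g`. -/
def minVal (L : ℕ) (a : EuclideanSpace ℝ (Fin n)) (g : Fin (n * L) → unitInterval) : ℝ :=
  (selected L a g).elim 0 (extend L a)

/-- The summand of the estimate for the hash function `g`. -/
def sampleValue (L : ℕ) (a b : EuclideanSpace ℝ (Fin n)) (g : Fin (n * L) → unitInterval) : ℝ :=
  if minHash L a g = minHash L b g then
    minVal L a g * minVal L b g / min (minVal L a g ^ 2) (minVal L b g ^ 2) else 0

theorem exists_selected_eq (a : EuclideanSpace ℝ (Fin n)) (g : Fin (n * L) → unitInterval)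
    (ha : (positions L a).Nonempty) :
    ∃ j, selected L a g = some j ∧ j ∈ positions L a ∧ ∀ k ∈ positions L a, g j ≤ g k :=
  firstArgmin_isSome (positions L a) (fun j => (g j : ℝ)) ha

theorem minHash_eq_inf' (a : EuclideanSpace ℝ (Fin n)) (g : Fin (n * L) → unitInterval)
    (ha : (positions L a).Nonempty) :
    minHash L a g = (positions L a).inf' ha fun j => (g j : ℝ) := by
  obtain ⟨j, hj, hja, hmin⟩ := exists_selected_eq a g ha
  rw [minHash, hj]
  exact le_antisymm ((Finset.le_inf'_iff _ _).2 fun k hk => hmin k hk)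
    (Finset.inf'_le (fun j => (g j : ℝ)) hja)

theorem min_minHash (a b : EuclideanSpace ℝ (Fin n)) (g : Fin (n * L) → unitInterval)
    (ha : (positions L a).Nonempty) (hb : (positions L b).Nonempty) :
    min (minHash L a g) (minHash L b g) =
      (positions L a ∪ positions L b).inf' (ha.mono Finset.subset_union_left)
        fun j => (g j : ℝ) := by
  rw [minHash_eq_inf' a g ha, minHash_eq_inf' b g hb, Finset.inf'_union ha hb]

theorem selected_eq_of_mem_strictMinAt {a : EuclideanSpace ℝ (Fin n)}
    {g : Fin (n * L) → unitInterval} {U : Finset (Fin (n * L))} (hU : positions L a ⊆ U)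
    {j : Fin (n * L)} (hj : j ∈ positions L a) (hg : g ∈ strictMinAt U j) :
    selected L a g = some j := by
  obtain ⟨i, hi, hia, hmin⟩ := exists_selected_eq a g ⟨j, hj⟩
  rw [hi]
  by_contra hne
  exact (hg i (hU hia) (by simpa using hne)).not_ge (hmin j hj)

theorem lt_minHash_of_mem_strictMinAt {a : EuclideanSpace ℝ (Fin n)}
    (ha : (positions L a).Nonempty)
    {g : Fin (n * L) → unitInterval} {U : Finset (Fin (n * L))} (hU : positions L a ⊆ U)
    {j : Fin (n * L)} (hj : j ∉ positions L a) (hg : g ∈ strictMinAt U j) :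
    (g j : ℝ) < minHash L a g := by
  rw [minHash_eq_inf' a g ha, Finset.lt_inf'_iff]
  exact fun i hi => hg i (hU hi) (fun h => hj (h ▸ hi))

/-- If the minimiser over the union is a position of both vectors, both sketches select it. If it
belongs to only one, the other minimum is strictly larger, so the hash values differ; the ratio is
then `0` too, because its numerator is. -/
theorem dependsOnArgmin_sampleValue {a b : EuclideanSpace ℝ (Fin n)}
    (ha : (positions L a).Nonempty) (hb : (positions L b).Nonempty) :
    DependsOnArgmin (positions L a ∪ positions L b) (ratio L a b) (sampleValue L a b) := by
  refine ⟨fun j hj g hg => ?_⟩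
  have hsel : ∀ {c : EuclideanSpace ℝ (Fin n)},
      positions L c ⊆ positions L a ∪ positions L b → j ∈ positions L c →
      minHash L c g = g j ∧ minVal L c g = extend L c j := fun hc hjc => by
    rw [minHash, minVal, selected_eq_of_mem_strictMinAt hc hjc hg]
    exact ⟨rfl, rfl⟩
  by_cases hja : j ∈ positions L a <;> by_cases hjb : j ∈ positions L b
  · obtain ⟨h1, h2⟩ := hsel Finset.subset_union_left hja
    obtain ⟨h3, h4⟩ := hsel Finset.subset_union_right hjb
    rw [sampleValue, h1, h2, h3, h4, if_pos rfl, ratio]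
  · have h1 := (hsel Finset.subset_union_left hja).1
    have h2 := lt_minHash_of_mem_strictMinAt hb Finset.subset_union_right hjb hg
    rw [sampleValue, if_neg (by rw [h1]; exact h2.ne), ratio,
      not_not.1 (mt mem_positions.2 hjb)]
    simp
  · have h1 := (hsel Finset.subset_union_right hjb).1
    have h2 := lt_minHash_of_mem_strictMinAt ha Finset.subset_union_left hja hg
    rw [sampleValue, if_neg (by rw [h1]; exact h2.ne'), ratio,
      not_not.1 (mt mem_positions.2 hja)]
    simp
  · exact absurd hj (by simp [hja, hjb])

theorem sum_ratio_union (a b : EuclideanSpace ℝ (Fin n)) {p : ℕ} (hp : p ≠ 0) :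
    ∑ j ∈ positions L a ∪ positions L b, ratio L a b j ^ p = ∑ j, ratio L a b j ^ p := by
  refine Finset.sum_subset (Finset.subset_univ _) fun j _ hj => ?_
  rw [Finset.mem_union, not_or] at hj
  rw [ratio, not_not.1 (mt mem_positions.2 hj.1)]
  simp [hp]

theorem estimate_sketch_eq {m : ℕ} (a b : EuclideanSpace ℝ (Fin n)) (h : Hashes n L m) :
    estimate L (sketch L h a) (sketch L h b) = ‖a‖ * ‖b‖ *
      (1 / (L : ℝ) * ((m : ℝ) / (∑ i, min (minHash L a (h i)) (minHash L b (h i))) - 1) / m *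
        ∑ i, sampleValue L a b (h i)) :=
  rfl

end Sample

/-! ### Error and failure probability of a single estimate. -/

/-- The deterministic part: `SX` is the sum of minimal hash values, `SY` the sum of sample values,
`D` the rounded inner product, and `m / SX - 1` estimates `u`. -/
theorem abs_estimate_sub_le {L u m η M SX SY D : ℝ} (hL : 1 ≤ L) (hLu : L ≤ u) (huL : u ≤ 2 * L)
    (hm : 0 < m) (hη : 0 < η) (hη₁ : η ≤ 1 / 2)
    (hX : |SX - m * (1 / (u + 1))| ≤ m * η * (1 / (u + 1)))
    (hY : |SY - m * (L * D / u)| ≤ m * η * (2 * M)) (hD : |D| ≤ 2 * M) :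
    |1 / L * (m / SX - 1) / m * SY - D| ≤ 20 * η * M := by
  have hu : 0 < u := by linarith
  set v := u + 1 with hv
  have hv0 : 0 < v := by linarith
  -- `s` is the relative size of `SX` against its mean, so `m / SX = v / s`.
  set s := SX * v / m with hs
  have hSX : SX = m * s / v := by rw [hs]; field_simp
  have hs1 : |s - 1| ≤ η := by
    have h1 : SX - m * (1 / v) = m / v * (s - 1) := by rw [hSX]; field_simp
    rw [h1, abs_mul, abs_of_pos (by positivity)] at hX
    have h2 : m * η * (1 / v) = m / v * η := by ring
    rw [h2] at hX
    exact le_of_mul_le_mul_left hX (by positivity)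
  have hs2 : 1 / 2 ≤ s := by linarith [(abs_le.1 hs1).1]
  have hs0 : 0 < s := by linarith
  have hinv : |1 / s - 1| ≤ 2 * η := by
    have : 1 / s - 1 = -(s - 1) / s := by field_simp; ring
    rw [this, abs_div, abs_neg, abs_of_pos hs0, div_le_iff₀ hs0]
    nlinarith
  have he : m / SX = v * (1 / s) := by rw [hSX]; field_simp
  set e := m / SX - 1 with he'
  have heu : |e - u| ≤ 4 * η * u := by
    have : e - u = v * (1 / s - 1) := by rw [he', he, hv]; ring
    rw [this, abs_mul, abs_of_pos hv0]
    calc v * |1 / s - 1| ≤ v * (2 * η) := by gcongr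
      _ ≤ (2 * u) * (2 * η) := by gcongr; linarith
      _ = _ := by ring
  have heL : |e / L| ≤ 6 := by
    rw [abs_div, abs_of_pos (by linarith : (0 : ℝ) < L), div_le_iff₀ (by linarith)]
    calc |e| = |(e - u) + u| := by ring_nf
      _ ≤ |e - u| + |u| := abs_add_le _ _
      _ ≤ 4 * η * u + u := by rw [abs_of_pos hu]; gcongr
      _ ≤ 6 * L := by nlinarith
  have hr : |SY / m - L * D / u| ≤ η * (2 * M) := by
    have : SY - m * (L * D / u) = m * (SY / m - L * D / u) := by field_simp
    rw [this, abs_mul, abs_of_pos hm, mul_assoc] at hY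
    exact le_of_mul_le_mul_left hY hm
  -- The first term carries the sampling error of `SY`, the second that of the union size. They
  -- contribute `6 * 2` and `4 * 2` to the constant `20`.
  have hsplit : 1 / L * e / m * SY - D =
      e / L * (SY / m - L * D / u) + (e - u) / u * D := by
    field_simp
    ring
  have hq : |(e - u) / u| ≤ 4 * η := by
    rw [abs_div, abs_of_pos hu, div_le_iff₀ hu]
    exact heu
  rw [hsplit]
  calc _ ≤ |e / L * (SY / m - L * D / u)| + |(e - u) / u * D| := abs_add_le _ _
    _ ≤ 6 * (η * (2 * M)) + 4 * η * (2 * M) := by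
      rw [abs_mul, abs_mul]
      gcongr
    _ = _ := by ring

theorem norm_restrict_sq {n : ℕ} (I : Finset (Fin n)) (a : EuclideanSpace ℝ (Fin n)) :
    ‖restrict I a‖ ^ 2 = ∑ i ∈ I, a i ^ 2 := by
  rw [EuclideanSpace.real_norm_sq_eq]
  have : ∀ i, restrict I a i ^ 2 = if i ∈ I then a i ^ 2 else 0 := fun i => by
    change (if i ∈ I then a i else 0) ^ 2 = _
    split_ifs <;> simp
  simp_rw [this]
  rw [← Finset.sum_filter]
  simp

theorem sum_normalize_sq {n : ℕ} (I : Finset (Fin n)) (a : EuclideanSpace ℝ (Fin n)) :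
    ∑ i ∈ I, (‖a‖⁻¹ • a) i ^ 2 = (‖restrict I a‖ / ‖a‖) ^ 2 := by
  rw [div_pow, norm_restrict_sq, div_eq_inv_mul, Finset.mul_sum]
  refine Finset.sum_congr rfl fun i _ => ?_
  rw [PiLp.smul_apply, smul_eq_mul, mul_pow, inv_pow]

theorem IsRounding.sum_sq {n L : ℕ} (hL : 0 < L) {z x : EuclideanSpace ℝ (Fin n)} {k : Fin n → ℕ}
    (h : IsRounding L z x k) : ∑ i, x i ^ 2 = 1 := by
  have hL' : (0 : ℝ) < L := by exact_mod_cast hL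
  have : (∑ i, x i ^ 2) * L = L := by
    rw [Finset.sum_mul]
    simp_rw [h.sq_mul]
    exact_mod_cast h.sum_eq
  exact mul_right_cancel₀ hL'.ne' (by rw [this, one_mul])

/-- The failure probability of a single Weighted MinHash estimate. -/
theorem volume_estimate_failure_le_of_ne_zero {n L m : ℕ} {a b : EuclideanSpace ℝ (Fin n)}
    (ha : a ≠ 0) (hb : b ≠ 0) (hL : 0 < L) (hn : n ^ 2 ≤ L) (hm : 0 < m) {η ε : ℝ} (hη : 0 < η)
    (hη₁ : η ≤ 1 / 2) (hmη : 32 ≤ m * η ^ 2) (hε : 20 * η + 3 * √(n ^ 2 / L) ≤ ε) :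
    (volume : Measure (Hashes n L m)) {h | ε * max (‖restrict (commonSupport a b) a‖ * ‖b‖)
        (‖a‖ * ‖restrict (commonSupport a b) b‖) <
      |estimate L (sketch L h a) (sketch L h b) - inner ℝ a b|} ≤ 1 / 16 := by
  set I := commonSupport a b with hI
  have hL' : (1 : ℝ) ≤ L := by exact_mod_cast hL
  have hm' : (0 : ℝ) < m := by exact_mod_cast hm
  have hna : 0 < ‖a‖ := norm_pos_iff.2 ha
  have hnb : 0 < ‖b‖ := norm_pos_iff.2 hb
  obtain ⟨k, hk⟩ : ∃ k, IsRounding L (‖a‖⁻¹ • a) (normRound L a) k :=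
    exists_isRounding_round hL hn (by
      rw [norm_smul, norm_inv, norm_norm, inv_mul_cancel₀ hna.ne'])
  obtain ⟨l, hl⟩ : ∃ l, IsRounding L (‖b‖⁻¹ • b) (normRound L b) l :=
    exists_isRounding_round hL hn (by
      rw [norm_smul, norm_inv, norm_norm, inv_mul_cancel₀ hnb.ne'])
  set x := normRound L a with hx
  set y := normRound L b with hy
  set z := ‖a‖⁻¹ • a with hz
  set w := ‖b‖⁻¹ • b with hw
  set M := max (‖restrict I a‖ / ‖a‖) (‖restrict I b‖ / ‖b‖) with hM
  have hM0 : 0 ≤ M := le_max_of_le_left (by positivity)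
  have hMab : max (‖restrict I a‖ * ‖b‖) (‖a‖ * ‖restrict I b‖) = ‖a‖ * ‖b‖ * M := by
    rw [hM, mul_max_of_nonneg _ _ (by positivity)]
    congr 1 <;> field_simp
  have hzM : ∑ i ∈ I, z i ^ 2 ≤ M ^ 2 := by
    rw [hz, sum_normalize_sq]
    exact pow_le_pow_left₀ (by positivity) (le_max_left _ _) 2
  have hwM : ∑ i ∈ I, w i ^ 2 ≤ M ^ 2 := by
    rw [hw, sum_normalize_sq]
    exact pow_le_pow_left₀ (by positivity) (le_max_right _ _) 2
  have hzero : ∀ i, i ∉ I → a i = 0 ∨ b i = 0 := fun i hi => by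
    simpa [hI, commonSupport, -not_and, not_and_or] using hi
  have hx0 : ∀ i, a i = 0 → x i = 0 := fun i h => by
    have := hk.sq_le i
    rw [hz, PiLp.smul_apply, h] at this
    exact pow_eq_zero_iff two_ne_zero |>.1 (le_antisymm (by simpa using this) (sq_nonneg _))
  have hy0 : ∀ i, b i = 0 → y i = 0 := fun i h => by
    have := hl.sq_le i
    rw [hw, PiLp.smul_apply, h] at this
    exact pow_eq_zero_iff two_ne_zero |>.1 (le_antisymm (by simpa using this) (sq_nonneg _))
  have hxyI : ∀ i, i ∉ I → x i * y i = 0 := fun i hi => by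
    rcases hzero i hi with h | h
    · rw [hx0 i h, zero_mul]
    · rw [hy0 i h, mul_zero]
  have hinner : inner ℝ a b = ‖a‖ * ‖b‖ * ∑ i ∈ I, z i * w i := by
    rw [PiLp.inner_apply, Finset.mul_sum, ← Finset.sum_subset (Finset.subset_univ I)]
    · refine Finset.sum_congr rfl fun i _ => ?_
      simp only [hz, hw, PiLp.smul_apply, smul_eq_mul]
      rw [real_inner_eq_re_inner]
      simp only [RCLike.inner_apply, conj_trivial, RCLike.re_to_real]
      field_simp
    · intro i _ hi
      rcases hzero i hi with h | h <;> simp [h]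
  have hxy : ∑ i, x i * y i = ∑ i ∈ I, x i * y i :=
    (Finset.sum_subset (Finset.subset_univ I) fun i _ hi => hxyI i hi).symm
  have hx2 : ∑ i ∈ I, x i ^ 2 ≤ 2 * M ^ 2 := by
    refine (Finset.sum_le_sum fun i _ => hk.sq_le i).trans ?_
    rw [← Finset.mul_sum]
    gcongr
  have hy2 : ∑ i ∈ I, y i ^ 2 ≤ 2 * M ^ 2 := by
    refine (Finset.sum_le_sum fun i _ => hl.sq_le i).trans ?_
    rw [← Finset.mul_sum]
    gcongr
  have hx1 : ∑ i ∈ I, x i ^ 2 ≤ 1 ^ 2 := by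
    rw [one_pow, ← hk.sum_sq hL]
    exact Finset.sum_le_sum_of_subset_of_nonneg (Finset.subset_univ _) fun _ _ _ => sq_nonneg _
  -- Only a bound linear in `M` is needed, so one factor is bounded by the full norm `1`.
  have hD : |∑ i, x i * y i| ≤ 2 * M := by
    rw [hxy, ← one_mul (2 * M)]
    exact sum_mul_sq_le_of_sq_le I x y zero_le_one (by positivity) hx1 (by nlinarith)
  have hround := abs_sum_mul_sub_le hL hk hl I hM0 hzM hwM
  have hA : (positions L a).Nonempty := Finset.card_pos.1 (by rwa [card_positions hL hk])
  have hB : (positions L b).Nonempty := Finset.card_pos.1 (by rwa [card_positions hL hl])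
  set U := positions L a ∪ positions L b with hU
  have hUne : U.Nonempty := hA.mono Finset.subset_union_left
  have hLU : (L : ℝ) ≤ U.card := by
    exact_mod_cast (card_positions hL hk).symm.le.trans
      (Finset.card_le_card Finset.subset_union_left)
  have hUL : (U.card : ℝ) ≤ 2 * L := by
    have := Finset.card_union_le (positions L a) (positions L b)
    rw [card_positions hL hk, card_positions hL hl, ← two_mul] at this
    exact_mod_cast this
  have hY := dependsOnArgmin_sampleValue hA hB
  -- In both applications of Chebyshev, `c` is `m * η` times a bound on the standard deviation of
  -- one sample, so `32 ≤ m * η ^ 2` gives failure probability `1 / 32`.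
  have hX := measure_pi_lt_abs_sum_sub_le (m := m) (p := 1 / 32)
    (c := m * η * (1 / ((U.card : ℝ) + 1))) _ (memLp_inf'_coe U hUne) (by positivity) (by
      refine (mul_le_mul_of_nonneg_left (variance_inf'_coe_le U hUne) hm'.le).trans ?_
      calc (m : ℝ) * (1 / ((U.card : ℝ) + 1)) ^ 2
          = 1 / 32 * (m * 32 * (1 / ((U.card : ℝ) + 1)) ^ 2) := by ring
        _ ≤ 1 / 32 * (m * (m * η ^ 2) * (1 / ((U.card : ℝ) + 1)) ^ 2) := by gcongr
        _ = _ := by ring)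
  have hYc := measure_pi_lt_abs_sum_sub_le (m := m) (p := 1 / 32) (c := m * η * (2 * M)) _
    (hY.memLp hUne) (by positivity) (by
      have hvar : ProbabilityTheory.variance (sampleValue L a b) volume ≤ (2 * M) ^ 2 := by
        refine (hY.variance_le hUne).trans ?_
        rw [sum_ratio_union a b two_ne_zero, div_le_iff₀ (by linarith)]
        refine (sum_ratio_sq_le hk hl I hxyI).trans ?_
        rw [mul_comm, Finset.sum_add_distrib]
        exact mul_le_mul (by linarith) hLU (by linarith) (by positivity)
      refine (mul_le_mul_of_nonneg_left hvar hm'.le).trans ?_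
      calc (m : ℝ) * (2 * M) ^ 2 = 1 / 32 * (m * 32 * (2 * M) ^ 2) := by ring
        _ ≤ 1 / 32 * (m * (m * η ^ 2) * (2 * M) ^ 2) := by gcongr
        _ = _ := by ring)
  have hmean : ∑ j ∈ U, ratio L a b j = L * ∑ i, x i * y i := by
    have := sum_ratio_union (L := L) a b one_ne_zero
    simp only [pow_one] at this
    rw [hU, this, sum_ratio hk hl]
  rw [integral_inf'_coe] at hX
  rw [hY.integral_eq hUne, hmean] at hYc
  have hsum : ENNReal.ofReal (1 / 32) + ENNReal.ofReal (1 / 32) = 1 / 16 := by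
    rw [← ENNReal.ofReal_add (by norm_num) (by norm_num)]
    norm_num
    rw [one_div, ENNReal.ofReal_inv_of_pos (by norm_num)]
    norm_num
  rw [← hsum]
  refine (measure_mono ?_).trans ((measure_union_le _ _).trans (add_le_add hX hYc))
  intro h hh
  by_contra hnot
  simp only [Set.mem_union, Set.mem_ofPred_eq, not_or, not_lt] at hnot hh
  have hest := abs_estimate_sub_le hL' hLU hUL hm' hη hη₁ hnot.1 hnot.2 hD
  refine hh.not_ge ?_
  rw [estimate_sketch_eq, hMab, hinner, ← mul_sub, abs_mul, abs_of_pos (by positivity),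
    mul_left_comm]
  refine mul_le_mul_of_nonneg_left ?_ (by positivity)
  simp_rw [min_minHash a b _ hA hB]
  refine (abs_sub_le _ (∑ i, x i * y i) _).trans ((add_le_add hest (hxy ▸ hround)).trans ?_)
  calc 20 * η * M + 3 * M * √(n ^ 2 / L) = (20 * η + 3 * √(n ^ 2 / L)) * M := by ring
    _ ≤ ε * M := by gcongr

theorem volume_estimate_failure_le {n L m : ℕ} (a b : EuclideanSpace ℝ (Fin n))
    (hL : 0 < n → 0 < L) (hn : n ^ 2 ≤ L) (hm : 0 < m) {η ε : ℝ} (hη : 0 < η)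
    (hη₁ : η ≤ 1 / 2) (hmη : 32 ≤ m * η ^ 2) (hε : 20 * η + 3 * √(n ^ 2 / L) ≤ ε) :
    (volume : Measure (Hashes n L m)) {h | ε * max (‖restrict (commonSupport a b) a‖ * ‖b‖)
        (‖a‖ * ‖restrict (commonSupport a b) b‖) <
      |estimate L (sketch L h a) (sketch L h b) - inner ℝ a b|} ≤ 1 / 16 := by
  have hε0 : 0 ≤ ε := le_trans (by positivity) hε
  by_cases hab : a = 0 ∨ b = 0
  -- For a zero vector the stored norm makes the estimate exactly `0`. This case includes `n = 0`,
  -- where `L` may be `0`.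
  · refine (measure_mono (t := ∅) fun h hh => ?_).trans (by simp)
    rw [Set.mem_ofPred_eq] at hh
    refine hh.not_ge ?_
    have h0 : |estimate L (sketch L h a) (sketch L h b) - inner ℝ a b| = 0 := by
      rw [estimate_sketch_eq]
      rcases hab with rfl | rfl <;> simp
    rw [h0]
    exact mul_nonneg hε0 (le_max_of_le_left (by positivity))
  · rw [not_or] at hab
    have hn0 : 0 < n := Nat.pos_of_ne_zero (by
      rintro rfl
      exact hab.1 (Subsingleton.elim _ _))
    exact volume_estimate_failure_le_of_ne_zero hab.1 hab.2 (hL hn0) hn hm hη hη₁ hmη hε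

/-! ### Passing to the median and choosing the constants. -/

/-- Taking medians amplifies a constant success probability. -/
theorem le_volume_real_median {Ω : Type*} [MeasureSpace Ω]
    [IsProbabilityMeasure (volume : Measure Ω)] (f : Ω → ℝ) {c r : ℝ}
    (hF : (volume : Measure Ω) {ω | r < |f ω - c|} ≤ 1 / 16) {t : ℕ} {δ : ℝ}
    (hδ : (1 / 2) ^ t ≤ δ) :
    1 - δ ≤ (volume : Measure (Fin t → Ω)).real {h | |median (fun i => f (h i)) - c| ≤ r} := by
  have hcompl : {h : Fin t → Ω | |median (fun i => f (h i)) - c| ≤ r}ᶜ ⊆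
      {h | ∃ T : Finset (Fin t), t ≤ 2 * T.card ∧ ∀ i ∈ T, h i ∈ {ω | r < |f ω - c|}} := by
    intro h hh
    refine ⟨Finset.univ.filter fun i => r < |f (h i) - c|, ?_, fun i hi => ?_⟩
    · by_contra! hlt
      exact hh (abs_median_sub_le _ _ _ hlt)
    · simpa using hi
  have hbad : (volume : Measure (Fin t → Ω)).real
      {h : Fin t → Ω | |median (fun i => f (h i)) - c| ≤ r}ᶜ ≤ (1 / 2) ^ t := by
    refine ENNReal.toReal_le_of_le_ofReal (by positivity) ?_
    refine (measure_mono hcompl).trans ((measure_pi_majority_le volume _ hF t).trans ?_)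
    rw [ENNReal.ofReal_pow (by norm_num), one_div, one_div, ENNReal.ofReal_inv_of_pos (by norm_num)]
    simp
  have hunion := measureReal_union_le (μ := (volume : Measure (Fin t → Ω)))
    {h : Fin t → Ω | |median (fun i => f (h i)) - c| ≤ r}
    {h : Fin t → Ω | |median (fun i => f (h i)) - c| ≤ r}ᶜ
  rw [Set.union_compl_self, probReal_univ] at hunion
  linarith

theorem exists_half_pow_le {δ : ℝ} (hδ : 0 < δ) :
    ∃ t : ℕ, 0 < t ∧ (1 / 2 : ℝ) ^ t ≤ δ ∧ (t : ℝ) ≤ 3 * max 1 (Real.log (1 / δ)) := by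
  set K := max 1 (Real.log (1 / δ)) with hK
  have hK1 : 1 ≤ K := le_max_left _ _
  have hlog := Real.log_two_gt_d9
  -- The factor `2` works because `2 * log 2 > 1`; the ceiling costs at most `1 ≤ K`, whence the
  -- bound `3 * K`.
  refine ⟨⌈2 * K⌉₊, Nat.ceil_pos.2 (by positivity), ?_, ?_⟩
  · have h1 : Real.log (1 / δ) ≤ ⌈2 * K⌉₊ * Real.log 2 := by
      have := Nat.le_ceil (2 * K)
      have h2 : Real.log (1 / δ) ≤ K := le_max_right _ _
      nlinarith
    rw [← Real.log_pow, Real.log_le_log_iff (by positivity) (by positivity)] at h1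
    rw [one_div_pow]
    exact (one_div_le hδ (by positivity)).1 h1
  · have := Nat.ceil_lt_add_one (show 0 ≤ 2 * K by positivity)
    linarith

end WMH

end

theorem theorem1 :
    ∃ C : ℝ, 0 < C ∧ ∀ ε δ : ℝ, 0 < ε → ε < 1 → 0 < δ → δ < 1 →
      ∃ m t : ℕ, 0 < m ∧ 0 < t ∧
        ((t * m : ℕ) : ℝ) ≤ C * max 1 (Real.log (1 / δ)) / ε ^ 2 ∧
        ∀ n L : ℕ, C * (n : ℝ) ^ 6 / ε ^ 2 ≤ (L : ℝ) →
          ∀ a b : EuclideanSpace ℝ (Fin n),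
            1 - δ ≤ (volume : Measure (Fin t → WMH.Hashes n L m)).real
              {h | |WMH.multiEstimate L (WMH.multiSketch L h a) (WMH.multiSketch L h b)
                      - inner ℝ a b|
                    ≤ ε * max (‖WMH.restrict (WMH.commonSupport a b) a‖ * ‖b‖)
                              (‖a‖ * ‖WMH.restrict (WMH.commonSupport a b) b‖)} := by
  -- The constant has two uses: it exceeds `3 * 51201`, for the sketch size, and it gives `√(n ^ 2 /
  -- L) ≤ ε / 1000`. Below, `η = ε / 40` makes the sampling error `20 * η = ε / 2`, and `32 / η ^ 2
  -- = 51200 / ε ^ 2` dictates `m`.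
  refine ⟨1000000, by norm_num, fun ε δ hε hε₁ hδ hδ₁ => ?_⟩
  obtain ⟨t, ht, htδ, htK⟩ := WMH.exists_half_pow_le hδ
  have hε2 : 0 < ε ^ 2 := by positivity
  have hε2' : ε ^ 2 ≤ 1 := pow_le_one₀ hε.le hε₁.le
  have hm₁ : 51200 / ε ^ 2 ≤ ⌈51200 / ε ^ 2⌉₊ := Nat.le_ceil _
  have hm₂ : (⌈51200 / ε ^ 2⌉₊ : ℝ) ≤ 51201 / ε ^ 2 := by
    have h1 := Nat.ceil_lt_add_one (show 0 ≤ 51200 / ε ^ 2 by positivity)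
    have h2 : 1 ≤ 1 / ε ^ 2 := by rwa [le_div_iff₀ hε2, one_mul]
    have h3 : 51201 / ε ^ 2 = 51200 / ε ^ 2 + 1 / ε ^ 2 := by ring
    linarith
  refine ⟨⌈51200 / ε ^ 2⌉₊, t, Nat.ceil_pos.2 (by positivity), ht, ?_, ?_⟩
  · push_cast
    have hK : (0 : ℝ) ≤ max 1 (Real.log (1 / δ)) := le_max_of_le_left zero_le_one
    calc (t : ℝ) * ⌈51200 / ε ^ 2⌉₊ ≤ 3 * max 1 (Real.log (1 / δ)) * (51201 / ε ^ 2) := by gcongr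
      _ = 153603 * max 1 (Real.log (1 / δ)) / ε ^ 2 := by ring
      _ ≤ _ := by gcongr; norm_num
  intro n L hL a b
  refine WMH.le_volume_real_median
    (fun h : WMH.Hashes n L ⌈51200 / ε ^ 2⌉₊ =>
      WMH.estimate L (WMH.sketch L h a) (WMH.sketch L h b)) ?_ htδ
  -- The argument only needs `L` of order `n ^ 2 / ε ^ 2`.
  have hn26 : (n : ℝ) ^ 2 ≤ n ^ 6 := by
    rcases Nat.eq_zero_or_pos n with rfl | hn
    · simp
    · exact pow_le_pow_right₀ (by exact_mod_cast hn) (by norm_num)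
  have hnL : 1000000 * (n : ℝ) ^ 2 ≤ L * ε ^ 2 := by
    rw [div_le_iff₀ hε2] at hL
    linarith
  have hL0 : 0 < n → 0 < L := fun hn => by
    have h1 : (0 : ℝ) < 1000000 * n ^ 2 := by positivity
    have h2 : (0 : ℝ) < L := pos_of_mul_pos_left (h1.trans_le hnL) hε2.le
    exact_mod_cast h2
  have hn2L : (n : ℝ) ^ 2 ≤ L := by
    have : (L : ℝ) * ε ^ 2 ≤ L := mul_le_of_le_one_right (Nat.cast_nonneg L) hε2'
    nlinarith [sq_nonneg (n : ℝ)]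
  refine WMH.volume_estimate_failure_le a b hL0 (by exact_mod_cast hn2L)
    (Nat.ceil_pos.2 (by positivity)) (η := ε / 40) (by positivity) (by linarith) ?_ ?_
  · rw [div_le_iff₀ hε2] at hm₁
    rw [div_pow]
    linarith
  · have : √((n : ℝ) ^ 2 / L) ≤ ε / 1000 := by
      rw [Real.sqrt_le_left (by positivity)]
      refine div_le_of_le_mul₀ (Nat.cast_nonneg L) (by positivity) ?_
      rw [div_pow]
      linarith
    linarith
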